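/- Let $r\ge 0$, $\mu\in\mathbb R$, $0<\gamma<1$, $\alpha<0$, $\beta>0$, $0\le T_0<T$, and let $\sigma:\mathbb R\to(0,\infty)$ be bounded and differentiable with bounded derivative and $\inf_y\sigma(y)>0$. Put $\tilde T=T-T_0$, $q_*=1/(1-\gamma)$, $\theta(y)=(\mu-r)/\sigma(y)$, $$Q(y)=\gamma\Big(r+\frac{|\theta(y)|^2}{2(1-\gamma)}\Big),\qquad Q_*=\sup_{y\in\mathbb R}Q(y),\qquad r^*=(\tilde T+1)e^{Q_*\tilde T},\qquad \mathcal K=[T_0,T]\times\mathbb R .$$ Let $\mathcal X$ be the set of continuous functions $f:\mathcal K\to[1,\infty)$ with $\sup_{\mathcal K}|f|\le r^*$. Let $U$ be a standard Brownian motion and, for $(t,y)\in\mathcal K$, let $(\eta^{t,y}_s)_{t\le s\le T}$ be the Ornstein–Uhlenbeck process $d\eta_s=\alpha\eta_s\,ds+\beta\,dU_s$ with $\eta_t=y$. For $f\in\mathcal X$ define $$\mathcal L_f(t,y)=\mathbf E\,\mathcal G(t,T,y)+\frac1{q_*}\int_t^T \mathbf E\Big[\big(f(s,\eta^{t,y}_s)\big)^{1-q_*}\,\mathcal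 G(t,s,y)\Big]ds,\qquad \mathcal G(t,s,y)=\exp\Big(\int_t^s Q(\eta^{t,y}_u)\,du\Big),$$ and set $h_0\equiv 1$, $h_n=\mathcal L_{h_{n-1}}$ for $n\ge1$. For $\zeta>0$ let $\varkappa=Q_*+\zeta+1$, $\lambda=1/(1+\zeta)$ and $B^*=e^{\varkappa\tilde T}(1+r^*)/(1-\lambda)$. For $n\ge 1$ let $C^*=(1+r^*)e^{(Q_*+1)\tilde T}$, $$g_n(x)=x\tilde T-\ln x-(n-1)\ln(1+x)\quad(x>0),\qquad g_n^*=\min_{x>0}g_n(x),\qquad U_n^*=C^*e^{g_n^*},$$ $$\zeta_n^*=\frac{\sqrt{(\tilde T-n)^2+4\tilde T}+n-\tilde T}{2\tilde T}.$$ Then: 1. For every $n\ge1$, $\zeta_n^*>0$, the minimum $g_n^*$ is attained at $x=\zeta_n^*$, the value of $B^*\lambda^n$ at $\zeta=\zeta_n^*$ is $U_n^*$, and $U_n^*\le B^*\lambda^n$ for every $\zeta>0$. 2. The fixed point problem $\mathcal L_h=h$ has a unique solution $h$ in $\mathcal X$, and for every $n\ge1$ $$\sup_{(t,y)\in\mathcal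 K}|h(t,y)-h_n(t,y)|\le U_n^* .$$ 3. For every $0<\delta<1$, $U_n^*=O(n^{-\delta n})$ as $n\to\infty$. The convergence of $h_n$ to $h$ is therefore super-geometric: $\sup_{\mathcal K}|h-h_n|=o(\rho^n)$ for every $\rho>0$. -/

import Mathlib

open MeasureTheory ProbabilityTheory Filter Asymptotics Set

noncomputable section

/-- The data of the market model with Ornstein-Uhlenbeck stochastic factor, the power utility
`x ^ γ` and the time interval `[T₀, T]`, with the standing assumptions on them. -/
structure OUMarket where
  /-- riskless interest rate -/
  r : ℝ
  /-- stock price appreciation rate -/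
  μ : ℝ
  /-- exponent of the power utility -/
  γ : ℝ
  /-- drift parameter of the Ornstein-Uhlenbeck factor -/
  α : ℝ
  /-- diffusion parameter of the Ornstein-Uhlenbeck factor -/
  β : ℝ
  /-- initial time -/
  T₀ : ℝ
  /-- terminal time -/
  T : ℝ
  /-- volatility, as a function of the factor -/
  σ : ℝ → ℝ
  r_nonneg : 0 ≤ r
  γ_pos : 0 < γ
  γ_lt_one : γ < 1
  α_neg : α < 0
  β_pos : 0 < β
  T₀_nonneg : 0 ≤ T₀
  T₀_lt_T : T₀ < T
  σ_bounded_below : ∃ σ₁ > 0, ∀ y, σ₁ ≤ σ y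
  σ_bounded : ∃ C, ∀ y, σ y ≤ C
  σ_differentiable : Differentiable ℝ σ
  σ_deriv_bounded : ∃ C, ∀ y, |deriv σ y| ≤ C

namespace OUMarket

variable (M : OUMarket)

/-- The length `T̃ = T - T₀` of the time interval. -/
def Ttilde : ℝ := M.T - M.T₀

/-- `q_* = (1 - γ)⁻¹`. -/
def qStar : ℝ := (1 - M.γ)⁻¹

/-- The risk premium `θ(y) = (μ - r) / σ(y)`. -/
def θ (y : ℝ) : ℝ := (M.μ - M.r) / M.σ y

/-- `Q(y) = γ (r + |θ(y)|² / (2 (1 - γ)))`. -/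
def Q (y : ℝ) : ℝ := M.γ * (M.r + |M.θ y| ^ 2 / (2 * (1 - M.γ)))

/-- `Q_* = sup_y Q(y)`. -/
def QStar : ℝ := ⨆ y : ℝ, M.Q y

/-- `r^* = (T̃ + 1) exp(Q_* T̃)`. -/
def rStar : ℝ := (M.Ttilde + 1) * Real.exp (M.QStar * M.Ttilde)

/-- The domain `K = [T₀, T] × ℝ`. -/
def K : Set (ℝ × ℝ) := Icc M.T₀ M.T ×ˢ univ

/-- The space `X` of the continuous functions on `K` with values in `[1, ∞)` that are bounded
by `r^*`. A function on `K` is represented by a function on `ℝ × ℝ`, in curried form, of which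
only the values on `K` matter. -/
def X : Set (ℝ → ℝ → ℝ) :=
  {f | ContinuousOn (Function.uncurry f) M.K ∧ ∀ p ∈ M.K, 1 ≤ f p.1 p.2 ∧ |f p.1 p.2| ≤ M.rStar}

/-- `sup_{(t, y) ∈ K} |f(t, y)|` (meaningful if this set of values is bounded). -/
def supK (f : ℝ → ℝ → ℝ) : ℝ := sSup ((fun p : ℝ × ℝ => |f p.1 p.2|) '' M.K)

variable {Ω : Type*}

/-- The Ornstein-Uhlenbeck process
`η_s^{t,y} = y e^{α(s-t)} + β ∫_t^s e^{α(s-v)} dU_v` driven by `U` and started from `y` at time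
`t`. The Wiener integral of the smooth deterministic integrand is written pathwise, by
integration by parts:
`∫_t^s e^{α(s-v)} dU_v = (U_s - U_t) + α ∫_t^s e^{α(s-v)} (U_v - U_t) dv`.
See `OUMarket.ou_sde` for the stochastic differential equation. -/
def ou (U : NNReal → Ω → ℝ) (t y s : ℝ) (ω : Ω) : ℝ :=
  y * Real.exp (M.α * (s - t)) +
    M.β * ((U s.toNNReal ω - U t.toNNReal ω) +
      M.α * ∫ v in t..s, Real.exp (M.α * (s - v)) * (U v.toNNReal ω - U t.toNNReal ω))

/-- Along every continuous path of `U`, the process `ou` satisfies `dη_s = α η_s ds + β dU_s`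
with `η_t = y`, in integral form. -/
theorem ou_sde (U : NNReal → Ω → ℝ) (ω : Ω) (hU : Continuous fun v => U v ω) (t y s : ℝ) :
    M.ou U t y s ω =
      y + M.α * (∫ u in t..s, M.ou U t y u ω) + M.β * (U s.toNNReal ω - U t.toNNReal ω) := by
  set W : ℝ → ℝ := fun v => U v.toNNReal ω - U t.toNNReal ω with hW
  have hWc : Continuous W := by
    have : Continuous fun v : ℝ => U v.toNNReal ω := hU.comp continuous_real_toNNReal
    exact this.sub continuous_const
  set g : ℝ → ℝ := fun v => Real.exp (-(M.α * v)) * W v with hg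
  have hgc : Continuous g := by fun_prop
  set I : ℝ → ℝ := fun u => Real.exp (M.α * u) * ∫ v in t..u, g v with hI
  have hou : ∀ u, M.ou U t y u ω =
      y * Real.exp (M.α * (u - t)) + M.β * (W u + M.α * I u) := by
    intro u
    have : I u = ∫ v in t..u, Real.exp (M.α * (u - v)) * W v := by
      simp only [hI, hg, ← intervalIntegral.integral_const_mul, ← mul_assoc, ← Real.exp_add]
      congr 1; ext v; congr 2; ring
    simp only [ou, this, hW]
  have hId : ∀ u, HasDerivAt I (M.α * I u + W u) u := by
    intro u
    have h1 : HasDerivAt (fun u => ∫ v in t..u, g v) (g u) u :=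
      intervalIntegral.integral_hasDerivAt_right (hgc.intervalIntegrable _ _)
        hgc.stronglyMeasurable.stronglyMeasurableAtFilter hgc.continuousAt
    have h2 : HasDerivAt (fun u => Real.exp (M.α * u)) (Real.exp (M.α * u) * (M.α * 1)) u :=
      ((hasDerivAt_id u).const_mul M.α).exp
    have h3 := h2.mul h1
    refine h3.congr_deriv ?_
    have : Real.exp (M.α * u) * Real.exp (-(M.α * u)) = 1 := by
      rw [← Real.exp_add]; simp
    simp only [hI, hg]
    linear_combination W u * this
  have hIc : Continuous I := continuous_iff_continuousAt.2 fun u => (hId u).continuousAt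
  have hF : ∀ u, HasDerivAt (fun u => y * Real.exp (M.α * (u - t)) + M.β * (M.α * I u))
      (M.α * M.ou U t y u ω) u := by
    intro u
    have h2 : HasDerivAt (fun u => Real.exp (M.α * (u - t)))
        (Real.exp (M.α * (u - t)) * (M.α * 1)) u :=
      (((hasDerivAt_id u).sub_const t).const_mul M.α).exp
    have h3 := (h2.const_mul y).add (((hId u).const_mul M.α).const_mul M.β)
    refine h3.congr_deriv ?_
    rw [hou u]; ring
  have hc : Continuous fun u => M.α * M.ou U t y u ω := by
    simp only [hou]; fun_prop
  have hftc := intervalIntegral.integral_eq_sub_of_hasDerivAt (fun u _ => hF u)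
    (hc.intervalIntegrable t s)
  have hIt : I t = 0 := by simp [hI]
  rw [intervalIntegral.integral_const_mul] at hftc
  rw [hftc, hou s, hIt]
  simp [hW]
  ring

/-- `G(t, s, y) = exp(∫_t^s Q(η_u^{t,y}) du)`. -/
def G (U : NNReal → Ω → ℝ) (t s y : ℝ) (ω : Ω) : ℝ :=
  Real.exp (∫ u in t..s, M.Q (M.ou U t y u ω))

variable [MeasurableSpace Ω]

/-- `H_f(t, s, y) = E [ f(s, η_s^{t,y})^{1 - q_*} G(t, s, y) ]`. -/
def H (P : Measure Ω) (U : NNReal → Ω → ℝ) (f : ℝ → ℝ → ℝ) (t s y : ℝ) : ℝ :=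
  ∫ ω, f s (M.ou U t y s ω) ^ (1 - M.qStar) * M.G U t s y ω ∂P

/-- The Feynman-Kac mapping
`L_f(t, y) = E G(t, T, y) + (1 / q_*) ∫_t^T H_f(t, s, y) ds`. -/
def L (P : Measure Ω) (U : NNReal → Ω → ℝ) (f : ℝ → ℝ → ℝ) (t y : ℝ) : ℝ :=
  (∫ ω, M.G U t M.T y ω ∂P) + 1 / M.qStar * ∫ s in t..M.T, M.H P U f t s y

/-- The iterates `h_0 = 1`, `h_n = L_{h_{n-1}}`. -/
def iter (P : Measure Ω) (U : NNReal → Ω → ℝ) : ℕ → ℝ → ℝ → ℝ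
  | 0 => fun _ _ => 1
  | n + 1 => M.L P U (iter P U n)

/-- `ϰ = Q_* + ζ + 1`. -/
def varkappa (ζ : ℝ) : ℝ := M.QStar + ζ + 1

/-- `λ = 1 / (ζ + 1)`. -/
def lam (ζ : ℝ) : ℝ := 1 / (ζ + 1)

/-- `B^* = exp(ϰ T̃) (1 + r^*) / (1 - λ)`. -/
def BStar (ζ : ℝ) : ℝ :=
  Real.exp (M.varkappa ζ * M.Ttilde) * (1 + M.rStar) / (1 - lam ζ)

/-- `C^* = (1 + r^*) exp((Q_* + 1) T̃)`. -/
def CStar : ℝ := (1 + M.rStar) * Real.exp ((M.QStar + 1) * M.Ttilde)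

/-- `g_n(x) = x T̃ - ln x - (n - 1) ln(1 + x)`. -/
def g (n : ℕ) (x : ℝ) : ℝ :=
  x * M.Ttilde - Real.log x - ((n : ℝ) - 1) * Real.log (1 + x)

/-- `g_n^* = min_{x > 0} g_n(x)`. -/
def gStar (n : ℕ) : ℝ := sInf (M.g n '' Ioi 0)

/-- `ζ_n^* = x_n^* = (√((T̃ - n)² + 4 T̃) + n - T̃) / (2 T̃)`. -/
def zetaStar (n : ℕ) : ℝ :=
  (Real.sqrt ((M.Ttilde - n) ^ 2 + 4 * M.Ttilde) + n - M.Ttilde) / (2 * M.Ttilde)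

/-- `U_n^* = C^* exp(g_n^*)`. -/
def UStar (n : ℕ) : ℝ := M.CStar * Real.exp (M.gStar n)

end OUMarket

end

/-!
A single application of the Feynman-Kac mapping `L` need not satisfy a contraction estimate in the
sup norm, but its iterates do, with factorial constants. The power `x ↦ x ^ (1 - q_*)` is Lipschitz
on `[1, ∞)` with constant `q_* - 1`, which the factor `1 / q_*` turns into `γ < 1`, and `G(t, s, y)
≤ exp(Q_* (s - t))`. Hence, if `|f - g|` is at most `c exp(Q_* (T - t)) (T - t) ^ n / n!` on `K`,
then `|L f - L g|` satisfies the same bound with `n + 1` in place of `n` (`abs_L_sub_L_le`). Two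
elements of `X` differ by at most `r^*`, so their `n`-th iterates differ by at most `err n = r^*
exp(Q_* T̃) T̃ ^ n / n!` (`abs_iterate_L_sub_le`). This gives uniqueness (`eq_of_L_eq`),
convergence of the iterates of `1` to a fixed point, and `|h - h_n| ≤ err n` (`exists_fixedPoint`).
By `x ^ n / n! ≤ exp x` with `x = (1 + ζ) T̃`, this error is below `B^* λ ^ n` for every `ζ > 0`,
in particular for `ζ = ζ_n^*`, where the bound is `U_n^*` (`err_le_UStar`). It is also `o(ρ ^ n)`
for every `ρ > 0`.

That `L` preserves `X` rests on `0 ≤ Q ≤ Q_*` for the bounds, and for the continuity on dominated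
convergence: the Ornstein-Uhlenbeck process, given pathwise, is jointly continuous in `(t, y, s)`
along each continuous path of the Brownian motion. Only the continuity of the paths and the
measurability of the marginals of the Brownian motion matter, and it is replaced by an
indistinguishable process for which both hold without exceptional set
(`exists_measurable_continuous_version`).

The minimum of `g_n` is found from `log u ≤ u - 1` (`isMinOn_g`), and the rate of `U_n^*` from the
choice `ζ = n` (`UStar_isBigO`).
-/

namespace OUMarket

variable (M : OUMarket)

/-! ### Parameters -/

lemma Ttilde_pos : 0 < M.Ttilde := sub_pos.2 M.T₀_lt_T

lemma one_sub_γ_pos : 0 < 1 - M.γ := sub_pos.2 M.γ_lt_one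

lemma one_div_qStar : 1 / M.qStar = 1 - M.γ := by simp [qStar]

lemma one_sub_qStar_neg : 1 - M.qStar < 0 := by
  have := (one_lt_inv₀ M.one_sub_γ_pos).2 (by linarith [M.γ_pos])
  rw [qStar]; linarith

/-- The Lipschitz constant `q_* - 1` of `x ↦ x ^ (1 - q_*)` is compensated by the factor
`1 / q_*` of the Feynman-Kac mapping. -/
lemma one_div_qStar_mul_abs : 1 / M.qStar * |1 - M.qStar| = M.γ := by
  have := M.one_sub_γ_pos.ne'
  rw [abs_of_neg M.one_sub_qStar_neg, one_div_qStar, qStar]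
  field_simp
  ring

lemma continuous_Q : Continuous M.Q := by
  obtain ⟨c, hc, h⟩ := M.σ_bounded_below
  have hσ : ∀ y, M.σ y ≠ 0 := fun y => (hc.trans_le (h y)).ne'
  have hσc := M.σ_differentiable.continuous
  have hθ : Continuous M.θ := continuous_const.div hσc hσ
  unfold Q
  fun_prop

lemma Q_nonneg (y : ℝ) : 0 ≤ M.Q y := by
  have := M.one_sub_γ_pos
  have := M.r_nonneg
  have := M.γ_pos
  unfold Q
  positivity

lemma bddAbove_Q : BddAbove (range M.Q) := by
  obtain ⟨c, hc, h⟩ := M.σ_bounded_below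
  refine ⟨M.γ * (M.r + (|M.μ - M.r| / c) ^ 2 / (2 * (1 - M.γ))), ?_⟩
  rintro _ ⟨y, rfl⟩
  have h1 := M.one_sub_γ_pos
  have h2 := M.γ_pos
  have h3 : |M.θ y| ≤ |M.μ - M.r| / c := by
    rw [θ, abs_div, abs_of_pos (hc.trans_le (h y))]
    gcongr
    exact h y
  unfold Q
  gcongr

lemma Q_le (y : ℝ) : M.Q y ≤ M.QStar := le_ciSup M.bddAbove_Q y

lemma QStar_nonneg : 0 ≤ M.QStar := (M.Q_nonneg 0).trans (M.Q_le 0)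

lemma one_le_rStar : 1 ≤ M.rStar := by
  have h1 := M.Ttilde_pos
  have h2 := Real.one_le_exp (mul_nonneg M.QStar_nonneg h1.le)
  unfold rStar
  nlinarith

lemma CStar_pos : 0 < M.CStar :=
  mul_pos (by linarith [M.one_le_rStar]) (Real.exp_pos _)

/-! ### The power `x ^ (1 - q_*)` on `[1, ∞)` -/

lemma rpow_nonneg_le_one {x : ℝ} (hx : 1 ≤ x) :
    0 ≤ x ^ (1 - M.qStar) ∧ x ^ (1 - M.qStar) ≤ 1 :=
  ⟨Real.rpow_nonneg (by linarith) _, Real.rpow_le_one_of_one_le_of_nonpos hx M.one_sub_qStar_neg.le⟩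

lemma abs_rpow_sub_rpow_le {x y : ℝ} (hx : 1 ≤ x) (hy : 1 ≤ y) :
    |x ^ (1 - M.qStar) - y ^ (1 - M.qStar)| ≤ |1 - M.qStar| * |x - y| := by
  refine (convex_Ici (1 : ℝ)).norm_image_sub_le_of_norm_hasDerivWithin_le
    (f := fun z => z ^ (1 - M.qStar)) (fun z hz => (Real.hasDerivAt_rpow_const
      (.inl (zero_lt_one.trans_le hz).ne')).hasDerivWithinAt) (fun z hz => ?_) hy hx
  have hz : 1 ≤ z := hz
  rw [norm_mul, Real.norm_of_nonneg (Real.rpow_nonneg (by linarith) _)]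
  have := M.one_sub_qStar_neg
  exact mul_le_of_le_one_right (norm_nonneg _)
    (Real.rpow_le_one_of_one_le_of_nonpos hz (by linarith))

/-! ### Optimization over `ζ` -/

lemma BStar_mul_lam_pow (n : ℕ) {ζ : ℝ} (hζ : 0 < ζ) :
    M.BStar ζ * lam ζ ^ n = M.CStar * Real.exp (M.g n ζ) := by
  have h1 : (0 : ℝ) < 1 + ζ := by linarith
  have h2 : Real.exp (M.g n ζ) = Real.exp (ζ * M.Ttilde) * ζ⁻¹ * ((1 + ζ) * ((1 + ζ) ^ n)⁻¹) := by
    rw [← Real.exp_log (inv_pos.2 hζ), ← Real.exp_log (inv_pos.2 (pow_pos h1 n)),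
      ← Real.exp_log h1, ← Real.exp_add, ← Real.exp_add, ← Real.exp_add, Real.exp_log h1,
      Real.log_inv, Real.log_inv, Real.log_pow, g]
    ring_nf
  have h3 : Real.exp (M.varkappa ζ * M.Ttilde) =
      Real.exp ((M.QStar + 1) * M.Ttilde) * Real.exp (ζ * M.Ttilde) := by
    rw [← Real.exp_add, varkappa]; ring_nf
  have h4 : 1 - 1 / (1 + ζ) = ζ / (1 + ζ) := by field_simp; ring
  rw [h2, BStar, CStar, lam, h3, add_comm ζ 1, h4, div_pow, one_pow]
  field_simp

lemma zetaStar_pos (n : ℕ) : 0 < M.zetaStar n := by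
  have hT := M.Ttilde_pos
  have : |M.Ttilde - n| < √((M.Ttilde - n) ^ 2 + 4 * M.Ttilde) := by
    rw [← Real.sqrt_sq_eq_abs]
    exact Real.sqrt_lt_sqrt (sq_nonneg _) (by linarith)
  have := (le_abs_self (M.Ttilde - n)).trans_lt this
  exact div_pos (by linarith) (by linarith)

lemma zetaStar_quadratic (n : ℕ) :
    M.Ttilde * M.zetaStar n ^ 2 + (M.Ttilde - n) * M.zetaStar n = 1 := by
  have hT := M.Ttilde_pos
  have hs := Real.sq_sqrt (x := (M.Ttilde - n) ^ 2 + 4 * M.Ttilde) (by positivity)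
  have := hT.ne'
  rw [zetaStar]
  generalize √((M.Ttilde - n) ^ 2 + 4 * M.Ttilde) = s at hs
  field_simp
  linear_combination hs

/-- The bounds `log u ≤ u - 1`, with `u = x / z` and `u = (1 + x) / (1 + z)`, put `g_n` above its
tangent at `z = ζ_n^*`, which is horizontal. -/
lemma isMinOn_g (n : ℕ) (hn : 1 ≤ n) : IsMinOn (M.g n) (Ioi 0) (M.zetaStar n) := by
  intro x (hx : 0 < x)
  have hz := M.zetaStar_pos n
  have hq := M.zetaStar_quadratic n
  set z := M.zetaStar n
  have hn' : (0 : ℝ) ≤ n - 1 := by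
    have : (1 : ℝ) ≤ n := by exact_mod_cast hn
    linarith
  have h1 := Real.log_le_sub_one_of_pos (div_pos hx hz)
  have h2 := Real.log_le_sub_one_of_pos (x := (1 + x) / (1 + z)) (by positivity)
  rw [Real.log_div hx.ne' hz.ne'] at h1
  rw [Real.log_div (by positivity) (by positivity)] at h2
  have h3 := mul_le_mul_of_nonneg_left h2 hn'
  have h4 : (x - z) * M.Ttilde - (x / z - 1) - (n - 1) * ((1 + x) / (1 + z) - 1) = 0 := by
    field_simp
    linear_combination (x - z) * hq
  change M.g n z ≤ M.g n x
  unfold g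
  linarith

lemma gStar_eq (n : ℕ) (hn : 1 ≤ n) : M.gStar n = M.g n (M.zetaStar n) := by
  refine IsLeast.csInf_eq ⟨mem_image_of_mem _ (M.zetaStar_pos n), ?_⟩
  rintro _ ⟨x, hx, rfl⟩
  exact M.isMinOn_g n hn hx

lemma UStar_le (n : ℕ) (hn : 1 ≤ n) {ζ : ℝ} (hζ : 0 < ζ) :
    M.UStar n ≤ M.CStar * Real.exp (M.g n ζ) := by
  have h : M.g n (M.zetaStar n) ≤ M.g n ζ := M.isMinOn_g n hn hζ
  rw [UStar, M.gStar_eq n hn]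
  have := M.CStar_pos
  gcongr

/-- With `ζ = n` the bound is at most `C^* exp(n T̃) n ^ (-n)`, and `exp(n T̃)` is absorbed by
`n ^ ((1 - δ) n)` once `T̃ ≤ (1 - δ) log n`. -/
lemma UStar_isBigO {δ : ℝ} (hδ : δ < 1) :
    M.UStar =O[atTop] fun n : ℕ => (n : ℝ) ^ (-δ * (n : ℝ)) := by
  have hlog : ∀ᶠ n : ℕ in atTop, M.Ttilde / (1 - δ) ≤ Real.log n :=
    (Real.tendsto_log_atTop.comp tendsto_natCast_atTop_atTop).eventually_ge_atTop _
  refine IsBigO.of_bound M.CStar ?_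
  filter_upwards [hlog, eventually_ge_atTop 1] with n h1 hn
  have hn1 : (1 : ℝ) ≤ n := by exact_mod_cast hn
  have hn0 : (0 : ℝ) < n := by linarith
  have hU : 0 ≤ M.UStar n := mul_nonneg M.CStar_pos.le (Real.exp_pos _).le
  rw [Real.norm_of_nonneg hU, Real.norm_of_nonneg (by positivity), Real.rpow_def_of_pos hn0]
  refine (M.UStar_le n hn hn0).trans ?_
  have := M.CStar_pos
  rw [div_le_iff₀ (by linarith)] at h1
  have h2 : Real.log n ≤ Real.log (1 + n) := Real.log_le_log hn0 (by linarith)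
  have h3 := mul_le_mul_of_nonneg_left h2 (sub_nonneg.2 hn1)
  have h4 := mul_le_mul_of_nonneg_left h1 hn0.le
  gcongr
  unfold g
  linarith

/-! ### The error bound for the iterates -/

/-- The bound `r^* exp(Q_* T̃) T̃ ^ n / n!` for the distance between the `n`-th iterates of two
elements of `X` under the Feynman-Kac mapping. -/
noncomputable def err (n : ℕ) : ℝ :=
  M.rStar * Real.exp (M.QStar * M.Ttilde) * (M.Ttilde ^ n / n.factorial)

/-- The factorial bound is at most `B^* λ ^ n` for every `ζ > 0`, by `x ^ n / n! ≤ exp x` for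
`x = (1 + ζ) T̃`. -/
lemma err_le (n : ℕ) {ζ : ℝ} (hζ : 0 < ζ) : M.err n ≤ M.BStar ζ * lam ζ ^ n := by
  have hT := M.Ttilde_pos
  have hr := M.one_le_rStar
  have h1 : 0 < ζ + 1 := by linarith
  have h2 : M.Ttilde ^ n / n.factorial ≤ Real.exp ((ζ + 1) * M.Ttilde) * lam ζ ^ n := by
    have := Real.pow_div_factorial_le_exp ((ζ + 1) * M.Ttilde) (by positivity) n
    rw [lam, one_div, inv_pow, ← div_eq_mul_inv, le_div_iff₀ (by positivity)]
    refine le_of_eq_of_le ?_ this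
    rw [mul_pow]; ring
  have h3 : 0 < lam ζ := by unfold lam; positivity
  have h4 : lam ζ < 1 := by rw [lam, div_lt_one h1]; linarith
  calc M.err n ≤ M.rStar * Real.exp (M.QStar * M.Ttilde) *
        (Real.exp ((ζ + 1) * M.Ttilde) * lam ζ ^ n) := by unfold err; gcongr
    _ = Real.exp (M.varkappa ζ * M.Ttilde) * M.rStar / 1 * lam ζ ^ n := by
        have : Real.exp (M.varkappa ζ * M.Ttilde) =
            Real.exp (M.QStar * M.Ttilde) * Real.exp ((ζ + 1) * M.Ttilde) := by
          rw [← Real.exp_add, varkappa]; ring_nf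
        rw [this]; ring
    _ ≤ M.BStar ζ * lam ζ ^ n := by
        have : 0 < 1 - lam ζ := by linarith
        unfold BStar
        gcongr <;> linarith

lemma err_le_UStar (n : ℕ) (hn : 1 ≤ n) : M.err n ≤ M.UStar n := by
  refine (M.err_le n (M.zetaStar_pos n)).trans_eq ?_
  rw [M.BStar_mul_lam_pow n (M.zetaStar_pos n), UStar, M.gStar_eq n hn]

lemma err_isLittleO {ρ : ℝ} (hρ : 0 < ρ) : M.err =o[atTop] fun n : ℕ => ρ ^ n := by
  refine (isLittleO_iff_tendsto' (.of_forall fun n h => absurd h (by positivity))).2 ?_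
  have := (FloorSemiring.tendsto_pow_div_factorial_atTop (M.Ttilde / ρ)).const_mul
    (M.rStar * Real.exp (M.QStar * M.Ttilde))
  rw [mul_zero] at this
  refine this.congr fun n => ?_
  rw [err, div_pow]
  field_simp

lemma tendsto_err : Tendsto M.err atTop (nhds 0) := by
  simpa [isLittleO_one_iff] using M.err_isLittleO one_pos

/-! ### A modification with continuous paths -/

/-- A process with almost surely continuous paths is indistinguishable from one all of whose paths
are continuous and all of whose marginals are measurable. -/
lemma exists_measurable_continuous_version {ι Ω : Type*} [PseudoMetricSpace ι]
    [TopologicalSpace.SeparableSpace ι] [Nonempty ι] [MeasurableSpace Ω] {P : Measure Ω}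
    {U : ι → Ω → ℝ} (hm : ∀ v, AEMeasurable (U v) P) (hc : ∀ᵐ ω ∂P, Continuous fun v => U v ω) :
    ∃ W : ι → Ω → ℝ, (∀ v, Measurable (W v)) ∧ (∀ ω, Continuous fun v => W v ω) ∧
      ∀ᵐ ω ∂P, ∀ v, U v ω = W v ω := by
  set d := TopologicalSpace.denseSeq ι
  have hd : ∀ᵐ ω ∂P, ∀ k, U (d k) ω = (hm (d k)).mk _ ω :=
    ae_all_iff.2 fun k => (hm (d k)).ae_eq_mk
  obtain ⟨S, hSae, hSm, hS⟩ := (hc.and hd).exists_measurable_mem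
  refine ⟨fun v => S.indicator (U v), fun v => ?_, fun ω => ?_, ?_⟩
  · have hdm : ∀ k, Measurable (S.indicator (U (d k))) := fun k => by
      have : S.indicator (U (d k)) = S.indicator ((hm (d k)).mk _) :=
        indicator_congr fun ω hω => (hS ω hω).2 k
      rw [this]
      exact (hm (d k)).measurable_mk.indicator hSm
    obtain ⟨x, hx, hxv⟩ :=
      mem_closure_iff_seq_limit.1 ((TopologicalSpace.denseRange_denseSeq ι) v)
    choose k hk using hx
    refine measurable_of_tendsto_metrizable (fun i => hdm (k i)) (tendsto_pi_nhds.2 fun ω => ?_)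
    by_cases hω : ω ∈ S
    · simp only [indicator_of_mem hω, d, hk]
      exact ((hS ω hω).1.tendsto v).comp hxv
    · simp [indicator_of_notMem hω]
  · by_cases hω : ω ∈ S
    · simpa only [indicator_of_mem hω] using (hS ω hω).1
    · simpa only [indicator_of_notMem hω] using continuous_const
  · filter_upwards [hSae] with ω hω v
    rw [indicator_of_mem hω]

/-! ### Parametric integrals -/

lemma continuous_intervalIntegral_of_continuous {X : Type*} [TopologicalSpace X]
    [FirstCountableTopology X] [LocallyCompactSpace X] {f : X → ℝ → ℝ} {a b : X → ℝ}
    (hf : Continuous (Function.uncurry f)) (ha : Continuous a) (hb : Continuous b) :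
    Continuous fun x => ∫ u in a x..b x, f x u := by
  have hi : ∀ x a b, IntervalIntegrable (f x) volume a b := fun x a b =>
    (hf.comp (Continuous.prodMk_right x)).intervalIntegrable a b
  have h : ∀ x, ∫ u in a x..b x, f x u =
      (∫ u in (0 : ℝ)..b x, f x u) - ∫ u in (0 : ℝ)..a x, f x u := fun x =>
    (intervalIntegral.integral_interval_sub_left (hi x _ _) (hi x _ _)).symm
  simp only [h]
  exact (intervalIntegral.continuous_parametric_intervalIntegral_of_continuous hf hb).sub
    (intervalIntegral.continuous_parametric_intervalIntegral_of_continuous hf ha)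

lemma measurable_intervalIntegral_of_continuous {Ω : Type*} [MeasurableSpace Ω] {F : ℝ → Ω → ℝ}
    (hm : ∀ u, Measurable (F u)) (hc : ∀ ω, Continuous fun u => F u ω) (a b : ℝ) :
    Measurable fun ω => ∫ u in a..b, F u ω := by
  have h : Measurable (Function.uncurry F) := measurable_uncurry_of_continuous_of_measurable hc hm
  have h' : StronglyMeasurable fun p : Ω × ℝ => F p.2 p.1 :=
    (h.comp measurable_swap).stronglyMeasurable
  simp only [intervalIntegral]
  exact (h'.integral_prod_right'.sub h'.integral_prod_right').measurable

/-- Continuity of a parametric integral over a finite measure, with a dominating function that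
depends continuously on the parameter. -/
lemma continuous_integral_of_le {X Ω : Type*} [TopologicalSpace X] [FirstCountableTopology X]
    [MeasurableSpace Ω] (P : Measure Ω) [IsFiniteMeasure P] {Z : X → Ω → ℝ} {B : X → ℝ}
    (hm : ∀ x, Measurable (Z x)) (hc : ∀ ω, Continuous fun x => Z x ω) (hB : Continuous B)
    (h : ∀ x ω, |Z x ω| ≤ B x) : Continuous fun x => ∫ ω, Z x ω ∂P := by
  refine continuous_iff_continuousAt.2 fun x₀ => ?_
  have hev : ∀ᶠ x in nhds x₀, B x ≤ B x₀ + 1 :=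
    (hB.continuousAt.eventually_lt_const (lt_add_one _)).mono fun _ => le_of_lt
  exact continuousAt_of_dominated (bound := fun _ => B x₀ + 1)
    (.of_forall fun x => (hm x).aestronglyMeasurable)
    (hev.mono fun x hx => .of_forall fun ω => (h x ω).trans hx) (integrable_const _)
    (.of_forall fun ω => (hc ω).continuousAt)

/-! ### The Ornstein-Uhlenbeck functional along a continuous path -/

section OUFunctional

variable {Ω : Type*} {W : NNReal → Ω → ℝ}

lemma continuous_ou {ω : Ω} (hc : Continuous fun v => W v ω) :
    Continuous fun p : ℝ × ℝ × ℝ => M.ou W p.1 p.2.1 p.2.2 ω := by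
  have h1 : Continuous fun v : ℝ => W v.toNNReal ω := hc.comp continuous_real_toNNReal
  have h2 : Continuous fun p : ℝ × ℝ × ℝ => ∫ v in p.1..p.2.2,
      Real.exp (M.α * (p.2.2 - v)) * (W v.toNNReal ω - W p.1.toNNReal ω) := by
    refine continuous_intervalIntegral_of_continuous ?_ (by fun_prop) (by fun_prop)
    simp only [Function.uncurry_def]
    fun_prop
  unfold ou
  fun_prop

lemma continuous_Q_ou {ω : Ω} (hc : Continuous fun v => W v ω) (t y : ℝ) :
    Continuous fun u => M.Q (M.ou W t y u ω) :=
  M.continuous_Q.comp ((M.continuous_ou hc).comp (f := fun u => (t, y, u)) (by fun_prop))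

lemma continuous_G {ω : Ω} (hc : Continuous fun v => W v ω) :
    Continuous fun p : ℝ × ℝ × ℝ => M.G W p.1 p.2.1 p.2.2 ω := by
  unfold G
  refine Real.continuous_exp.comp ?_
  refine continuous_intervalIntegral_of_continuous ?_ (by fun_prop) (by fun_prop)
  exact M.continuous_Q.comp ((M.continuous_ou hc).comp
    (f := fun q : (ℝ × ℝ × ℝ) × ℝ => (q.1.1, q.1.2.2, q.2)) (by fun_prop))

lemma G_pos (t s y : ℝ) (ω : Ω) : 0 < M.G W t s y ω := Real.exp_pos _

lemma G_le_exp_abs (t s y : ℝ) (ω : Ω) : M.G W t s y ω ≤ Real.exp (M.QStar * |s - t|) := by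
  refine Real.exp_le_exp.2 ((le_abs_self _).trans ?_)
  rw [← Real.norm_eq_abs]
  refine intervalIntegral.norm_integral_le_of_norm_le_const fun u _ => ?_
  rw [Real.norm_of_nonneg (M.Q_nonneg _)]
  exact M.Q_le _

lemma G_le_exp {t s : ℝ} (hts : t ≤ s) (y : ℝ) (ω : Ω) :
    M.G W t s y ω ≤ Real.exp (M.QStar * (s - t)) := by
  simpa [abs_of_nonneg (sub_nonneg.2 hts)] using M.G_le_exp_abs (W := W) t s y ω

lemma one_le_G {t s : ℝ} (hts : t ≤ s) (y : ℝ) (ω : Ω) : 1 ≤ M.G W t s y ω :=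
  Real.one_le_exp (intervalIntegral.integral_nonneg hts fun _ _ => M.Q_nonneg _)

variable {f g : ℝ → ℝ → ℝ}

lemma continuous_H_integrand (hf : Continuous (Function.uncurry f)) (hf1 : ∀ t y, 1 ≤ f t y)
    {ω : Ω} (hc : Continuous fun v => W v ω) :
    Continuous fun p : ℝ × ℝ × ℝ =>
      f p.2.1 (M.ou W p.1 p.2.2 p.2.1 ω) ^ (1 - M.qStar) * M.G W p.1 p.2.1 p.2.2 ω := by
  have h1 : Continuous fun p : ℝ × ℝ × ℝ => M.ou W p.1 p.2.2 p.2.1 ω :=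
    (M.continuous_ou hc).comp (f := fun p : ℝ × ℝ × ℝ => (p.1, p.2.2, p.2.1)) (by fun_prop)
  have h2 : Continuous fun p : ℝ × ℝ × ℝ => f p.2.1 (M.ou W p.1 p.2.2 p.2.1 ω) :=
    hf.comp (f := fun p : ℝ × ℝ × ℝ => (p.2.1, M.ou W p.1 p.2.2 p.2.1 ω)) (by fun_prop)
  exact (h2.rpow_const fun p => .inl (zero_lt_one.trans_le (hf1 _ _)).ne').mul
    (M.continuous_G hc)

lemma H_integrand_nonneg_le (hf1 : ∀ t y, 1 ≤ f t y) (t s y : ℝ) (ω : Ω) :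
    0 ≤ f s (M.ou W t y s ω) ^ (1 - M.qStar) * M.G W t s y ω ∧
      f s (M.ou W t y s ω) ^ (1 - M.qStar) * M.G W t s y ω ≤ Real.exp (M.QStar * |s - t|) := by
  obtain ⟨h1, h2⟩ := M.rpow_nonneg_le_one (hf1 s (M.ou W t y s ω))
  have h3 : 0 < M.G W t s y ω := Real.exp_pos _
  exact ⟨by positivity, (mul_le_of_le_one_left h3.le h2).trans (M.G_le_exp_abs t s y ω)⟩

/-! ### Measurability and integrability -/

variable [MeasurableSpace Ω]

lemma measurable_ou (hm : ∀ v, Measurable (W v)) (hc : ∀ ω, Continuous fun v => W v ω)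
    (t y s : ℝ) : Measurable (M.ou W t y s) := by
  have h : Measurable fun ω => ∫ v in t..s,
      Real.exp (M.α * (s - v)) * (W v.toNNReal ω - W t.toNNReal ω) := by
    refine measurable_intervalIntegral_of_continuous (fun u => ?_) (fun ω => ?_) t s
    · exact ((hm _).sub (hm _)).const_mul _
    · have h1 : Continuous fun v : ℝ => W v.toNNReal ω := (hc ω).comp continuous_real_toNNReal
      fun_prop
  unfold ou
  exact (((hm _).sub (hm _)).add (h.const_mul _)).const_mul _ |>.const_add _

lemma measurable_G (hm : ∀ v, Measurable (W v)) (hc : ∀ ω, Continuous fun v => W v ω)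
    (t s y : ℝ) : Measurable (M.G W t s y) := by
  unfold G
  refine Real.measurable_exp.comp (measurable_intervalIntegral_of_continuous (fun u => ?_)
    (fun ω => M.continuous_Q_ou (hc ω) t y) t s)
  exact M.continuous_Q.measurable.comp (M.measurable_ou hm hc t y u)

lemma measurable_H_integrand (hm : ∀ v, Measurable (W v)) (hc : ∀ ω, Continuous fun v => W v ω)
    (hf : Continuous (Function.uncurry f)) (t s y : ℝ) :
    Measurable fun ω => f s (M.ou W t y s ω) ^ (1 - M.qStar) * M.G W t s y ω := by
  have h : Continuous (f s) := hf.comp (Continuous.prodMk_right s)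
  exact ((h.measurable.comp (M.measurable_ou hm hc t y s)).pow_const _).mul
    (M.measurable_G hm hc t s y)

variable (P : Measure Ω)

lemma H_nonneg (hf1 : ∀ t y, 1 ≤ f t y) (t s y : ℝ) : 0 ≤ M.H P W f t s y :=
  integral_nonneg fun ω => (M.H_integrand_nonneg_le (W := W) hf1 t s y ω).1

variable [IsProbabilityMeasure P]

lemma integrable_G (hm : ∀ v, Measurable (W v)) (hc : ∀ ω, Continuous fun v => W v ω)
    (t s y : ℝ) : Integrable (M.G W t s y) P := by
  refine .of_bound (M.measurable_G hm hc t s y).aestronglyMeasurable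
    (Real.exp (M.QStar * |s - t|)) (.of_forall fun ω => ?_)
  rw [Real.norm_of_nonneg (M.G_pos t s y ω).le]
  exact M.G_le_exp_abs t s y ω

lemma integrable_H_integrand (hm : ∀ v, Measurable (W v))
    (hc : ∀ ω, Continuous fun v => W v ω) (hf : Continuous (Function.uncurry f))
    (hf1 : ∀ t y, 1 ≤ f t y) (t s y : ℝ) :
    Integrable (fun ω => f s (M.ou W t y s ω) ^ (1 - M.qStar) * M.G W t s y ω) P := by
  refine .of_bound (M.measurable_H_integrand hm hc hf t s y).aestronglyMeasurable
    (Real.exp (M.QStar * |s - t|)) (.of_forall fun ω => ?_)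
  have h := M.H_integrand_nonneg_le (W := W) hf1 t s y ω
  rw [Real.norm_of_nonneg h.1]
  exact h.2

/-! ### Continuity of the Feynman-Kac mapping -/

lemma continuous_H (hm : ∀ v, Measurable (W v)) (hc : ∀ ω, Continuous fun v => W v ω)
    (hf : Continuous (Function.uncurry f)) (hf1 : ∀ t y, 1 ≤ f t y) :
    Continuous fun p : ℝ × ℝ × ℝ => M.H P W f p.1 p.2.1 p.2.2 := by
  refine continuous_integral_of_le P (B := fun p : ℝ × ℝ × ℝ => Real.exp (M.QStar * |p.2.1 - p.1|))
    (fun p => M.measurable_H_integrand hm hc hf _ _ _)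
    (fun ω => M.continuous_H_integrand hf hf1 (hc ω)) (by fun_prop) fun p ω => ?_
  have h := M.H_integrand_nonneg_le (W := W) hf1 p.1 p.2.1 p.2.2 ω
  rw [abs_of_nonneg h.1]
  exact h.2

lemma continuous_H_time (hm : ∀ v, Measurable (W v)) (hc : ∀ ω, Continuous fun v => W v ω)
    (hf : Continuous (Function.uncurry f)) (hf1 : ∀ t y, 1 ≤ f t y) (t y : ℝ) :
    Continuous fun s => M.H P W f t s y :=
  (M.continuous_H P hm hc hf hf1).comp (f := fun s : ℝ => (t, s, y)) (by fun_prop)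

lemma continuous_L (hm : ∀ v, Measurable (W v)) (hc : ∀ ω, Continuous fun v => W v ω)
    (hf : Continuous (Function.uncurry f)) (hf1 : ∀ t y, 1 ≤ f t y) :
    Continuous (Function.uncurry (M.L P W f)) := by
  have h1 : Continuous fun p : ℝ × ℝ => ∫ ω, M.G W p.1 M.T p.2 ω ∂P := by
    refine continuous_integral_of_le P (B := fun p : ℝ × ℝ => Real.exp (M.QStar * |M.T - p.1|))
      (fun p => M.measurable_G hm hc _ _ _)
      (fun ω => (M.continuous_G (hc ω)).comp (f := fun p : ℝ × ℝ => (p.1, M.T, p.2))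
        (by fun_prop)) (by fun_prop) fun p ω => ?_
    rw [abs_of_pos (M.G_pos _ _ _ _)]
    exact M.G_le_exp_abs _ _ _ _
  have h2 : Continuous fun p : ℝ × ℝ => ∫ s in p.1..M.T, M.H P W f p.1 s p.2 := by
    refine continuous_intervalIntegral_of_continuous ?_ (by fun_prop) (by fun_prop)
    exact (M.continuous_H P hm hc hf hf1).comp
      (f := fun q : (ℝ × ℝ) × ℝ => (q.1.1, q.2, q.1.2)) (by fun_prop)
  exact h1.add (h2.const_mul _)

/-! ### Bounds for the Feynman-Kac mapping -/

lemma H_le (hf1 : ∀ t y, 1 ≤ f t y) (t s y : ℝ) :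
    M.H P W f t s y ≤ Real.exp (M.QStar * |s - t|) := by
  have hle : ∀ ω, ‖f s (M.ou W t y s ω) ^ (1 - M.qStar) * M.G W t s y ω‖ ≤
      Real.exp (M.QStar * |s - t|) := fun ω => by
    have h := M.H_integrand_nonneg_le (W := W) hf1 t s y ω
    rw [Real.norm_of_nonneg h.1]
    exact h.2
  have h := norm_integral_le_of_norm_le_const (μ := P) (.of_forall hle)
  rw [probReal_univ, mul_one] at h
  exact (le_abs_self _).trans h

lemma one_le_L (hm : ∀ v, Measurable (W v)) (hc : ∀ ω, Continuous fun v => W v ω)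
    (hf1 : ∀ t y, 1 ≤ f t y) {t : ℝ} (ht : t ≤ M.T) (y : ℝ) : 1 ≤ M.L P W f t y := by
  have h1 : (1 : ℝ) ≤ ∫ ω, M.G W t M.T y ω ∂P := by
    have := integral_mono (integrable_const (1 : ℝ)) (M.integrable_G P hm hc t M.T y)
      fun ω => M.one_le_G ht y ω
    simpa using this
  have h2 : 0 ≤ ∫ s in t..M.T, M.H P W f t s y :=
    intervalIntegral.integral_nonneg ht fun s _ => M.H_nonneg P hf1 t s y
  have h3 := M.one_sub_γ_pos
  unfold L
  rw [one_div_qStar]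
  have := mul_nonneg h3.le h2
  linarith

lemma L_le (hm : ∀ v, Measurable (W v)) (hc : ∀ ω, Continuous fun v => W v ω)
    (hf : Continuous (Function.uncurry f)) (hf1 : ∀ t y, 1 ≤ f t y) {t : ℝ}
    (ht : t ∈ Icc M.T₀ M.T) (y : ℝ) : M.L P W f t y ≤ M.rStar := by
  set e := Real.exp (M.QStar * M.Ttilde)
  have he : ∀ s ∈ Icc t M.T, Real.exp (M.QStar * |s - t|) ≤ e := fun s hs => by
    refine Real.exp_le_exp.2 (mul_le_mul_of_nonneg_left ?_ M.QStar_nonneg)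
    rw [abs_of_nonneg (sub_nonneg.2 hs.1), Ttilde]
    linarith [hs.2, ht.1]
  have h1 : ∫ ω, M.G W t M.T y ω ∂P ≤ e := by
    have := integral_mono (M.integrable_G P hm hc t M.T y) (integrable_const e)
      fun ω => (M.G_le_exp_abs t M.T y ω).trans (he _ ⟨ht.2, le_rfl⟩)
    simpa using this
  have h2 : ∫ s in t..M.T, M.H P W f t s y ≤ (M.T - t) * e := by
    have := intervalIntegral.integral_mono_on ht.2
      ((M.continuous_H_time P hm hc hf hf1 t y).intervalIntegrable _ _)
      (intervalIntegrable_const (μ := volume) (c := e))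
      fun s hs => (M.H_le P hf1 t s y).trans (he s hs)
    simpa using this
  have h3 := M.one_sub_γ_pos
  have h4 : 0 ≤ ∫ s in t..M.T, M.H P W f t s y :=
    intervalIntegral.integral_nonneg ht.2 fun s _ => M.H_nonneg P hf1 t s y
  have h5 : (M.T - t) * e ≤ M.Ttilde * e := by
    unfold Ttilde
    have := ht.1
    gcongr
  have h6 := mul_le_of_le_one_left h4 (by linarith [M.γ_pos] : 1 - M.γ ≤ 1)
  unfold L rStar
  rw [one_div_qStar]
  linarith

/-- The pathwise estimate behind the contraction: the Lipschitz bound for `x ↦ x ^ (1 - q_*)`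
combined with `G(t, s, y) ≤ exp(Q_* (s - t))`. -/
lemma abs_H_sub_H_le (hm : ∀ v, Measurable (W v)) (hc : ∀ ω, Continuous fun v => W v ω)
    (hf : Continuous (Function.uncurry f)) (hf1 : ∀ t y, 1 ≤ f t y)
    (hg : Continuous (Function.uncurry g)) (hg1 : ∀ t y, 1 ≤ g t y)
    {t s : ℝ} (hts : t ≤ s) (y : ℝ) {b : ℝ} (hb : ∀ z, |f s z - g s z| ≤ b) :
    |M.H P W f t s y - M.H P W g t s y| ≤
      |1 - M.qStar| * b * Real.exp (M.QStar * (s - t)) := by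
  have hb0 : 0 ≤ b := (abs_nonneg _).trans (hb 0)
  rw [H, H, ← integral_sub (M.integrable_H_integrand P hm hc hf hf1 t s y)
    (M.integrable_H_integrand P hm hc hg hg1 t s y)]
  have hle : ∀ ω, ‖f s (M.ou W t y s ω) ^ (1 - M.qStar) * M.G W t s y ω -
      g s (M.ou W t y s ω) ^ (1 - M.qStar) * M.G W t s y ω‖ ≤
      |1 - M.qStar| * b * Real.exp (M.QStar * (s - t)) := fun ω => by
    rw [← sub_mul, norm_mul, Real.norm_of_nonneg (M.G_pos t s y ω).le, Real.norm_eq_abs]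
    have h1 := M.abs_rpow_sub_rpow_le (hf1 s (M.ou W t y s ω)) (hg1 s (M.ou W t y s ω))
    have h2 := hb (M.ou W t y s ω)
    have h3 := M.G_le_exp (W := W) hts y ω
    have h4 := (M.G_pos (W := W) t s y ω).le
    refine mul_le_mul (h1.trans ?_) h3 h4 (by positivity)
    gcongr
  have h := norm_integral_le_of_norm_le_const (μ := P) (.of_forall hle)
  rwa [probReal_univ, mul_one] at h

/-- One application of the Feynman-Kac mapping integrates the bound
`c exp(Q_* (T - t)) (T - t) ^ n / n!` once more in time. -/
lemma abs_L_sub_L_le (hm : ∀ v, Measurable (W v)) (hc : ∀ ω, Continuous fun v => W v ω)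
    (hf : Continuous (Function.uncurry f)) (hf1 : ∀ t y, 1 ≤ f t y)
    (hg : Continuous (Function.uncurry g)) (hg1 : ∀ t y, 1 ≤ g t y) (n : ℕ) {c t : ℝ}
    (hc0 : 0 ≤ c) (ht : t ≤ M.T)
    (hfg : ∀ s ∈ Icc t M.T, ∀ y, |f s y - g s y| ≤
      c * Real.exp (M.QStar * (M.T - s)) * ((M.T - s) ^ n / n.factorial)) (y : ℝ) :
    |M.L P W f t y - M.L P W g t y| ≤
      c * Real.exp (M.QStar * (M.T - t)) * ((M.T - t) ^ (n + 1) / (n + 1).factorial) := by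
  have hfi := (M.continuous_H_time P hm hc hf hf1 t y).intervalIntegrable (μ := volume) t M.T
  have hgi := (M.continuous_H_time P hm hc hg hg1 t y).intervalIntegrable (μ := volume) t M.T
  set e := c * Real.exp (M.QStar * (M.T - t))
  have he : 0 ≤ e := by positivity
  have hint : ∫ s in t..M.T, (M.T - s) ^ n / n.factorial =
      (M.T - t) ^ (n + 1) / (n + 1).factorial := by
    rw [intervalIntegral.integral_div,
      intervalIntegral.integral_comp_sub_left (fun x => x ^ n) M.T, integral_pow]
    simp [Nat.factorial_succ, div_div]
  have hpt : ∀ s ∈ Ioc t M.T, ‖M.H P W f t s y - M.H P W g t s y‖ ≤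
      |1 - M.qStar| * e * ((M.T - s) ^ n / n.factorial) := fun s hs => by
    refine (M.abs_H_sub_H_le P hm hc hf hf1 hg hg1 hs.1.le y
      (hfg s ⟨hs.1.le, hs.2⟩)).trans_eq ?_
    have : Real.exp (M.QStar * (M.T - t)) =
        Real.exp (M.QStar * (M.T - s)) * Real.exp (M.QStar * (s - t)) := by
      rw [← Real.exp_add]; ring_nf
    simp only [e, this]
    ring
  have hI : |(∫ s in t..M.T, M.H P W f t s y) - ∫ s in t..M.T, M.H P W g t s y| ≤
      |1 - M.qStar| * e * ((M.T - t) ^ (n + 1) / (n + 1).factorial) := by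
    rw [← intervalIntegral.integral_sub hfi hgi, ← hint, ← intervalIntegral.integral_const_mul]
    refine intervalIntegral.norm_integral_le_of_norm_le ht (.of_forall hpt) ?_
    exact Continuous.intervalIntegrable (by fun_prop) _ _
  have hq : 0 < 1 / M.qStar := M.one_div_qStar ▸ M.one_sub_γ_pos
  have hd : 0 ≤ (M.T - t) ^ (n + 1) / ((n + 1).factorial : ℝ) := by
    have := sub_nonneg.2 ht
    positivity
  calc |M.L P W f t y - M.L P W g t y|
      = 1 / M.qStar *
        |(∫ s in t..M.T, M.H P W f t s y) - ∫ s in t..M.T, M.H P W g t s y| := by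
        rw [L, L, add_sub_add_left_eq_sub, ← mul_sub, abs_mul, abs_of_pos hq]
    _ ≤ 1 / M.qStar * (|1 - M.qStar| * e * ((M.T - t) ^ (n + 1) / (n + 1).factorial)) := by
        gcongr
    _ = M.γ * (e * ((M.T - t) ^ (n + 1) / (n + 1).factorial)) := by
        rw [← M.one_div_qStar_mul_abs]; ring
    _ ≤ e * ((M.T - t) ^ (n + 1) / (n + 1).factorial) :=
        mul_le_of_le_one_left (by positivity) M.γ_lt_one.le

end OUFunctional

/-! ### The Feynman-Kac mapping on `X` -/

/-- Replacement of the time variable by its projection to `[T₀, T]`, which turns a function that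
is continuous on `K` into one that is continuous on the plane, without changing it on `K`. -/
noncomputable def clampTime (f : ℝ → ℝ → ℝ) (t y : ℝ) : ℝ := f (projIcc M.T₀ M.T M.T₀_lt_T.le t) y

section FunctionSpace

variable {M} {f g : ℝ → ℝ → ℝ}

lemma clampTime_of_mem {t : ℝ} (ht : t ∈ Icc M.T₀ M.T) (y : ℝ) : M.clampTime f t y = f t y := by
  rw [clampTime, projIcc_of_mem _ ht]

lemma continuous_clampTime (hf : f ∈ M.X) : Continuous (Function.uncurry (M.clampTime f)) := by
  have h : Continuous fun p : ℝ × ℝ => ((projIcc M.T₀ M.T M.T₀_lt_T.le p.1 : ℝ), p.2) :=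
    (continuous_subtype_val.comp (continuous_projIcc.comp continuous_fst)).prodMk continuous_snd
  exact hf.1.comp_continuous h fun p => ⟨Subtype.coe_prop _, mem_univ _⟩

lemma one_le_clampTime (hf : f ∈ M.X) (t y : ℝ) : 1 ≤ M.clampTime f t y :=
  (hf.2 (projIcc M.T₀ M.T M.T₀_lt_T.le t, y) ⟨Subtype.coe_prop _, mem_univ _⟩).1

lemma one_mem_X : (fun _ _ => 1) ∈ M.X :=
  ⟨continuousOn_const, fun _ _ => ⟨le_rfl, by simpa using M.one_le_rStar⟩⟩

lemma abs_sub_le_rStar (hf : f ∈ M.X) (hg : g ∈ M.X) {p : ℝ × ℝ} (hp : p ∈ M.K) :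
    |f p.1 p.2 - g p.1 p.2| ≤ M.rStar := by
  obtain ⟨h1, h2⟩ := hf.2 p hp
  obtain ⟨h3, h4⟩ := hg.2 p hp
  exact abs_sub_le_of_nonneg_of_le (by linarith) ((le_abs_self _).trans h2) (by linarith)
    ((le_abs_self _).trans h4)

end FunctionSpace

section FixedPoint

variable {Ω : Type*} [MeasurableSpace Ω] (P : Measure Ω) {W : NNReal → Ω → ℝ}
  {f g : ℝ → ℝ → ℝ}

/-- `L` depends on the driving process only up to indistinguishability. -/
lemma L_congr_process {U : NNReal → Ω → ℝ} (h : ∀ᵐ ω ∂P, ∀ v, U v ω = W v ω) :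
    M.L P U = M.L P W := by
  have hou : ∀ᵐ ω ∂P, ∀ t y s, M.ou U t y s ω = M.ou W t y s ω :=
    h.mono fun ω hω t y s => by simp only [ou, hω]
  have hG : ∀ᵐ ω ∂P, ∀ t s y, M.G U t s y ω = M.G W t s y ω :=
    hou.mono fun ω hω t s y => by simp only [G, hω]
  funext f t y
  have h1 : ∫ ω, M.G U t M.T y ω ∂P = ∫ ω, M.G W t M.T y ω ∂P :=
    integral_congr_ae (hG.mono fun ω hω => hω _ _ _)
  have h2 : ∀ s, M.H P U f t s y = M.H P W f t s y := fun s =>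
    integral_congr_ae (by filter_upwards [hou, hG] with ω h1 h2; simp only [h1, h2])
  simp only [L, h1, h2]

variable {M}

lemma L_congr (h : ∀ p ∈ M.K, f p.1 p.2 = g p.1 p.2) {p : ℝ × ℝ} (hp : p ∈ M.K) :
    M.L P W f p.1 p.2 = M.L P W g p.1 p.2 := by
  have hH : ∫ s in p.1..M.T, M.H P W f p.1 s p.2 = ∫ s in p.1..M.T, M.H P W g p.1 s p.2 := by
    refine intervalIntegral.integral_congr fun s hs => ?_
    rw [uIcc_of_le hp.1.2] at hs
    have hfg : ∀ y, f s y = g s y := fun y => h (s, y) ⟨Icc_subset_Icc_left hp.1.1 hs, mem_univ _⟩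
    simp only [H, hfg]
  rw [L, L, hH]

lemma L_clampTime {p : ℝ × ℝ} (hp : p ∈ M.K) :
    M.L P W (M.clampTime f) p.1 p.2 = M.L P W f p.1 p.2 :=
  L_congr P (fun q hq => clampTime_of_mem hq.1 q.2) hp

lemma iterate_L_eq (hfix : ∀ p ∈ M.K, M.L P W f p.1 p.2 = f p.1 p.2) (n : ℕ) :
    ∀ p ∈ M.K, (M.L P W)^[n] f p.1 p.2 = f p.1 p.2 := by
  induction n with
  | zero => exact fun _ _ => rfl
  | succ n ih =>
    intro p hp
    rw [Function.iterate_succ_apply', L_congr P ih hp, hfix p hp]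

lemma iter_eq_iterate (n : ℕ) : M.iter P W n = (M.L P W)^[n] fun _ _ => 1 := by
  induction n with
  | zero => rfl
  | succ n ih => rw [Function.iterate_succ_apply', ← ih, iter]

variable [IsProbabilityMeasure P]

lemma L_mem_X (hm : ∀ v, Measurable (W v)) (hc : ∀ ω, Continuous fun v => W v ω) (hf : f ∈ M.X) :
    M.L P W f ∈ M.X := by
  have hfc := continuous_clampTime hf
  have hf1 := one_le_clampTime hf
  refine ⟨(M.continuous_L P hm hc hfc hf1).continuousOn.congr fun p hp =>
    (L_clampTime P hp).symm, fun p hp => ?_⟩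
  rw [← L_clampTime P hp]
  have h1 := M.one_le_L P hm hc hf1 hp.1.2 p.2
  rw [abs_of_nonneg (by linarith)]
  exact ⟨h1, M.L_le P hm hc hfc hf1 hp.1 p.2⟩

lemma abs_L_sub_L_le_of_mem (hm : ∀ v, Measurable (W v)) (hc : ∀ ω, Continuous fun v => W v ω)
    (hf : f ∈ M.X) (hg : g ∈ M.X) (n : ℕ) {c : ℝ} (hc0 : 0 ≤ c)
    (hfg : ∀ p ∈ M.K, |f p.1 p.2 - g p.1 p.2| ≤
      c * Real.exp (M.QStar * (M.T - p.1)) * ((M.T - p.1) ^ n / n.factorial))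
    {p : ℝ × ℝ} (hp : p ∈ M.K) :
    |M.L P W f p.1 p.2 - M.L P W g p.1 p.2| ≤
      c * Real.exp (M.QStar * (M.T - p.1)) * ((M.T - p.1) ^ (n + 1) / (n + 1).factorial) := by
  rw [← L_clampTime P hp, ← L_clampTime P (f := g) hp]
  refine M.abs_L_sub_L_le P hm hc (continuous_clampTime hf) (one_le_clampTime hf)
    (continuous_clampTime hg) (one_le_clampTime hg) n hc0 hp.1.2 (fun s hs y => ?_) p.2
  have hs' : s ∈ Icc M.T₀ M.T := Icc_subset_Icc_left hp.1.1 hs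
  rw [clampTime_of_mem hs', clampTime_of_mem hs']
  exact hfg (s, y) ⟨hs', mem_univ _⟩

lemma iterate_L_mem_X (hm : ∀ v, Measurable (W v)) (hc : ∀ ω, Continuous fun v => W v ω)
    (hf : f ∈ M.X) (n : ℕ) : (M.L P W)^[n] f ∈ M.X := by
  induction n with
  | zero => exact hf
  | succ n ih =>
    rw [Function.iterate_succ_apply']
    exact L_mem_X P hm hc ih

/-- The induction starts from the distance `r^*`, an upper bound for the diameter of `X`. -/
lemma abs_iterate_L_sub_le (hm : ∀ v, Measurable (W v)) (hc : ∀ ω, Continuous fun v => W v ω)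
    (hf : f ∈ M.X) (hg : g ∈ M.X) (n : ℕ) {p : ℝ × ℝ} (hp : p ∈ M.K) :
    |(M.L P W)^[n] f p.1 p.2 - (M.L P W)^[n] g p.1 p.2| ≤ M.err n := by
  have hr : 0 ≤ M.rStar := zero_le_one.trans M.one_le_rStar
  have hQ := M.QStar_nonneg
  have key : ∀ n, ∀ p ∈ M.K, |(M.L P W)^[n] f p.1 p.2 - (M.L P W)^[n] g p.1 p.2| ≤
      M.rStar * Real.exp (M.QStar * (M.T - p.1)) * ((M.T - p.1) ^ n / n.factorial) := by
    intro n
    induction n with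
    | zero =>
      intro p hp
      refine (abs_sub_le_rStar hf hg hp).trans ?_
      have := Real.one_le_exp (mul_nonneg hQ (sub_nonneg.2 hp.1.2))
      simpa using le_mul_of_one_le_right hr this
    | succ n ih =>
      intro p hp
      simp only [Function.iterate_succ_apply']
      exact abs_L_sub_L_le_of_mem P hm hc (iterate_L_mem_X P hm hc hf n)
        (iterate_L_mem_X P hm hc hg n) n hr ih hp
  refine (key n p hp).trans ?_
  have h0 : 0 ≤ M.T - p.1 := sub_nonneg.2 hp.1.2
  have h1 : M.T - p.1 ≤ M.Ttilde := by unfold Ttilde; linarith [hp.1.1]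
  unfold err
  gcongr

/-- A fixed point on `K` agrees there with all its iterates, so two of them differ by at most
`r^* exp(Q_* T̃) T̃ ^ n / n!` for every `n`. -/
lemma eq_of_L_eq (hm : ∀ v, Measurable (W v)) (hc : ∀ ω, Continuous fun v => W v ω)
    (hf : f ∈ M.X) (hg : g ∈ M.X) (hfix : ∀ p ∈ M.K, M.L P W f p.1 p.2 = f p.1 p.2)
    (hgix : ∀ p ∈ M.K, M.L P W g p.1 p.2 = g p.1 p.2) {p : ℝ × ℝ} (hp : p ∈ M.K) :
    f p.1 p.2 = g p.1 p.2 := by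
  have h : |f p.1 p.2 - g p.1 p.2| ≤ 0 := ge_of_tendsto' M.tendsto_err fun n => by
    have := abs_iterate_L_sub_le P hm hc hf hg n hp
    rwa [iterate_L_eq P hfix n p hp, iterate_L_eq P hgix n p hp] at this
  exact sub_eq_zero.1 (abs_nonpos_iff.1 h)

/-- The iterates of `1` are uniformly Cauchy on `K`, because `h_{n+k}` is the `n`-th iterate of
`h_k ∈ X`; their uniform limit is a fixed point. -/
lemma exists_fixedPoint (hm : ∀ v, Measurable (W v)) (hc : ∀ ω, Continuous fun v => W v ω) :
    ∃ h ∈ M.X, (∀ p ∈ M.K, M.L P W h p.1 p.2 = h p.1 p.2) ∧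
      ∀ n, ∀ p ∈ M.K, |h p.1 p.2 - M.iter P W n p.1 p.2| ≤ M.err n := by
  set u : ℕ → ℝ → ℝ → ℝ := M.iter P W
  have hu : ∀ n, u n = (M.L P W)^[n] fun _ _ => 1 := iter_eq_iterate P
  have huX : ∀ n, u n ∈ M.X := fun n => hu n ▸ iterate_L_mem_X P hm hc one_mem_X n
  have hcauchy : ∀ n m, n ≤ m → ∀ p ∈ M.K, |u m p.1 p.2 - u n p.1 p.2| ≤ M.err n := by
    intro n m hnm p hp
    obtain ⟨k, rfl⟩ := Nat.exists_eq_add_of_le hnm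
    rw [hu (n + k), hu n, Function.iterate_add_apply, ← hu k]
    exact abs_iterate_L_sub_le P hm hc (huX k) one_mem_X n hp
  have hlim : ∀ p ∈ M.K, ∃ l, Tendsto (fun n => u n p.1 p.2) atTop (nhds l) := fun p hp =>
    cauchySeq_tendsto_of_complete <| cauchySeq_of_le_tendsto_0' M.err
      (fun n m hnm => by rw [dist_comm]; exact hcauchy n m hnm p hp) M.tendsto_err
  choose! l hl using hlim
  have herr : ∀ n, ∀ p ∈ M.K, |l p - u n p.1 p.2| ≤ M.err n := fun n p hp =>
    le_of_tendsto ((hl p hp).sub_const _).abs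
      ((eventually_ge_atTop n).mono fun m hm => hcauchy n m hm p hp)
  have hunif : TendstoUniformlyOn (fun n => Function.uncurry (u n)) l atTop M.K := by
    rw [Metric.tendstoUniformlyOn_iff]
    intro ε hε
    filter_upwards [M.tendsto_err.eventually_lt_const hε] with n hn p hp
    exact (herr n p hp).trans_lt hn
  have hlX : (fun t y => l (t, y)) ∈ M.X := by
    refine ⟨hunif.continuousOn (.of_forall fun n => (huX n).1), fun p hp => ⟨?_, ?_⟩⟩
    · exact ge_of_tendsto' (hl p hp) fun n => ((huX n).2 p hp).1
    · exact le_of_tendsto' (hl p hp).abs fun n => ((huX n).2 p hp).2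
  refine ⟨fun t y => l (t, y), hlX, fun p hp => ?_, herr⟩
  -- the constant bound `err n` is the case of exponent `0` in the estimate for `L`
  have hstep : ∀ n, |M.L P W (fun t y => l (t, y)) p.1 p.2 - u (n + 1) p.1 p.2| ≤
      M.err n * Real.exp (M.QStar * (M.T - p.1)) * ((M.T - p.1) ^ (0 + 1) / (0 + 1).factorial) := by
    intro n
    have he : 0 ≤ M.err n := (abs_nonneg _).trans (herr n p hp)
    refine abs_L_sub_L_le_of_mem P hm hc hlX (huX n) 0 he (fun q hq => ?_) hp
    refine (herr n q hq).trans ?_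
    have := Real.one_le_exp (mul_nonneg M.QStar_nonneg (sub_nonneg.2 hq.1.2))
    simpa using le_mul_of_one_le_right he this
  have hL : Tendsto (fun n => u (n + 1) p.1 p.2) atTop
      (nhds (M.L P W (fun t y => l (t, y)) p.1 p.2)) := by
    have h0 := (M.tendsto_err.mul_const (Real.exp (M.QStar * (M.T - p.1)))).mul_const
      ((M.T - p.1) ^ (0 + 1) / ((0 + 1).factorial : ℝ))
    rw [zero_mul, zero_mul] at h0
    refine tendsto_iff_dist_tendsto_zero.2 (squeeze_zero (fun _ => dist_nonneg) (fun n => ?_) h0)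
    rw [dist_comm]
    exact hstep n
  exact tendsto_nhds_unique hL ((hl p hp).comp (tendsto_add_atTop_nat 1))

end FixedPoint

lemma supK_nonneg (f : ℝ → ℝ → ℝ) : 0 ≤ M.supK f := by
  refine Real.sSup_nonneg ?_
  rintro _ ⟨p, _, rfl⟩
  exact abs_nonneg _

lemma supK_le {f : ℝ → ℝ → ℝ} {b : ℝ} (h : ∀ p ∈ M.K, |f p.1 p.2| ≤ b) : M.supK f ≤ b := by
  have hne : M.K.Nonempty := ⟨(M.T₀, 0), ⟨le_rfl, M.T₀_lt_T.le⟩, mem_univ _⟩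
  refine csSup_le (hne.image _) ?_
  rintro _ ⟨p, hp, rfl⟩
  exact h p hp

end OUMarket

theorem mainTheorem4 (M : OUMarket) {Ω : Type*} [MeasurableSpace Ω] (P : Measure Ω)
    [IsProbabilityMeasure P] (U : NNReal → Ω → ℝ) (hU : IsBrownianReal U P) :
    -- the choice `ζ = ζ_n^*` is optimal in the bound `B^* λ^n`, whose optimal value is `U_n^*`
    (∀ n : ℕ, 1 ≤ n →
      0 < M.zetaStar n ∧
      IsMinOn (M.g n) (Ioi 0) (M.zetaStar n) ∧
      M.gStar n = M.g n (M.zetaStar n) ∧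
      M.UStar n = M.BStar (M.zetaStar n) * OUMarket.lam (M.zetaStar n) ^ n ∧
      ∀ ζ : ℝ, 0 < ζ → M.UStar n ≤ M.BStar ζ * OUMarket.lam ζ ^ n) ∧
    -- the fixed point problem has a unique solution, and the iterates obey the bound `U_n^*`
    (∃ h ∈ M.X,
      (∀ p ∈ M.K, M.L P U h p.1 p.2 = h p.1 p.2) ∧
      (∀ f ∈ M.X, (∀ p ∈ M.K, M.L P U f p.1 p.2 = f p.1 p.2) →
        ∀ p ∈ M.K, f p.1 p.2 = h p.1 p.2) ∧
      (∀ n : ℕ, 1 ≤ n →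
        BddAbove ((fun p : ℝ × ℝ => |h p.1 p.2 - M.iter P U n p.1 p.2|) '' M.K) ∧
        M.supK (fun t y => h t y - M.iter P U n t y) ≤ M.UStar n) ∧
      -- the convergence is faster than any geometric one
      (∀ ρ : ℝ, 0 < ρ →
        (fun n : ℕ => M.supK (fun t y => h t y - M.iter P U n t y))
          =o[atTop] fun n : ℕ => ρ ^ n)) ∧
    -- `U_n^* = O(n^{-δ n})`
    (∀ δ : ℝ, 0 < δ → δ < 1 →
      M.UStar =O[atTop] fun n : ℕ => (n : ℝ) ^ (-δ * (n : ℝ))) := by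
  refine ⟨fun n hn => ⟨M.zetaStar_pos n, M.isMinOn_g n hn, M.gStar_eq n hn, ?_, fun ζ hζ => ?_⟩,
    ?_, fun δ _ hδ => M.UStar_isBigO hδ⟩
  · rw [M.BStar_mul_lam_pow n (M.zetaStar_pos n), OUMarket.UStar, M.gStar_eq n hn]
  · rw [M.BStar_mul_lam_pow n hζ]
    exact M.UStar_le n hn hζ
  obtain ⟨W, hm, hc, hUW⟩ :=
    OUMarket.exists_measurable_continuous_version hU.aemeasurable hU.cont
  have hL : M.L P U = M.L P W := M.L_congr_process P hUW
  have hiter : M.iter P U = M.iter P W := by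
    funext n
    rw [OUMarket.iter_eq_iterate, OUMarket.iter_eq_iterate, hL]
  obtain ⟨h, hX, hfix, herr⟩ := OUMarket.exists_fixedPoint (M := M) P hm hc
  rw [hL, hiter]
  refine ⟨h, hX, hfix, fun f hf hffix p hp => OUMarket.eq_of_L_eq P hm hc hf hX hffix hfix hp,
    fun n hn => ⟨⟨M.err n, ?_⟩, (M.supK_le (herr n)).trans (M.err_le_UStar n hn)⟩, fun ρ hρ => ?_⟩
  · rintro _ ⟨p, hp, rfl⟩
    exact herr n p hp
  · refine (IsBigO.of_bound 1 (.of_forall fun n => ?_)).trans_isLittleO (M.err_isLittleO hρ)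
    rw [one_mul, Real.norm_of_nonneg (M.supK_nonneg _)]
    exact (M.supK_le (herr n)).trans (le_abs_self _)
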